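/- Polytopes are nonempty convex hulls of finite point sets in $\mathbb{R}^d$. For a polytope $P$ and an integer $k$, let $f_k(P)$ be the number of $k$-dimensional faces of $P$ (the empty face has dimension $-1$, and $P$ is a face of itself). Every nonempty face $F$ of a Minkowski sum $P_1+\cdots+P_r$ decomposes uniquely as $F=F_1+\cdots+F_r$ with $F_i$ a face of $P_i$; the decomposition is exact if $\dim F=\dim F_1+\cdots+\dim F_r$. The polytopes $P_1,\ldots,P_r$ are relatively in general position if every nonempty facet of $P_1+\cdots+P_r$ (that is, every nonempty face of dimension $\dim(P_1+\cdots+P_r)-1$) has an exact decomposition. Theorem. Let $P_1,\ldots,P_r$ be polytopes in $\mathbb{R}^d$ and $P=P_1+\cdots+P_r$ their Minkowski sum. There are polytopes $P'_1,\ldots,P'_r$ in $\mathbb{R}^d$, relatively in general position, with Minkowski sum $P'=P'_1+\cdots+P'_r$, such that $f_k(P'_i)=f_k(P_i)$ for all $i$ and all $k$, and $f_k(P')\geq f_k(P)$ for all $k$. Consequently, for each $k$, the maximum of $f_k(Q_1+\cdots+Q_r)$ over all polytopes $Q_1,\ldots,Q_r$ in $\mathbb{R}^d$ with $f_j(Q_i)=f_j(P_i)$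 for all $i$ and $j$ is attained by polytopes that are relatively in general position. -/

import Mathlib

open scoped Pointwise

/-- A (nonempty) convex polytope: the convex hull of a nonempty finite set of points. -/
def IsConvexPolytope {E : Type*} [AddCommGroup E] [Module ℝ E] (P : Set E) : Prop :=
  ∃ s : Finset E, s.Nonempty ∧ P = convexHull ℝ (s : Set E)

/-- The dimension of a convex set: the dimension of its affine hull, with `dim ∅ = -1`. -/
noncomputable def polyDim {E : Type*} [AddCommGroup E] [Module ℝ E] (F : Set E) : ℤ :=
  open Classical in
  if F.Nonempty then (Module.finrank ℝ (vectorSpan ℝ F) : ℤ) else -1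

/-- `F` is a face of `P`: either `F` is empty, or `F` is the set of points of `P` at which some
linear functional attains its maximum over `P` (the zero functional gives `P` itself). -/
def IsPolytopeFace {E : Type*} [AddCommGroup E] [Module ℝ E] [TopologicalSpace E]
    (P F : Set E) : Prop :=
  IsExposed ℝ P F

/-- `f_k(P)`: the number of `k`-dimensional faces of `P` (a polytope has finitely many faces). The
index `k` is an integer, and the empty face is counted at `k = -1`. -/
noncomputable def faceNumber {E : Type*} [AddCommGroup E] [Module ℝ E] [TopologicalSpace E]
    (P : Set E) (k : ℤ) : ℕ :=
  Set.ncard {F : Set E | IsPolytopeFace P F ∧ polyDim F = k}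

/-- `G` is a decomposition of the set `F` into faces of the summands `P i`: each `G i` is a face
of `P i`, and `F` is the Minkowski sum of the `G i`. -/
def IsFaceDecomposition {E : Type*} [AddCommGroup E] [Module ℝ E] [TopologicalSpace E] {r : ℕ}
    (P : Fin r → Set E) (F : Set E) (G : Fin r → Set E) : Prop :=
  (∀ i, IsPolytopeFace (P i) (G i)) ∧ F = ∑ i, G i

/-- `F` has an exact decomposition: its dimension is the sum of the dimensions of the faces
in its decomposition. -/
def HasExactDecomposition {E : Type*} [AddCommGroup E] [Module ℝ E] [TopologicalSpace E] {r : ℕ}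
    (P : Fin r → Set E) (F : Set E) : Prop :=
  ∃ G : Fin r → Set E, IsFaceDecomposition P F G ∧ polyDim F = ∑ i, polyDim (G i)

/-- The `P i` are relatively in general position: every (nonempty) facet of their Minkowski sum
has an exact decomposition. -/
def RelativelyInGeneralPosition {E : Type*} [AddCommGroup E] [Module ℝ E] [TopologicalSpace E]
    {r : ℕ} (P : Fin r → Set E) : Prop :=
  ∀ F : Set E, IsPolytopeFace (∑ i, P i) F → F.Nonempty →
    polyDim F = polyDim (∑ i, P i) - 1 → HasExactDecomposition P F

/-! Replace each `P i` by `T i '' P i`, with linear maps `T i` that are generic and close to the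
identity. Being invertible, they keep the face numbers of each summand. A face of the new sum is a
sum of images of faces of the `P i`, so general position only asks that finitely many families of
subspaces, the directions of these faces, be mapped into general position. This holds for a dense
set of `T` (`dense_setOf_forall_le_finrank_iSup_map`, `relativelyInGeneralPosition_image`).

The main point is that face numbers are lower semicontinuous in the Hausdorff distance
(`IsConvexPolytope.exists_forall_faceNumber_le`). Let `u` expose a face `F` of `P`, and project onto
the direction of `F`. For `Q` close to `P` and `w` close to the projection of a relative interior
point `x` of `F`, an extreme point among the `u`-highest points of `Q` over `w` lies in the relative
interior of a face `H`. Extremality makes the projection injective on the direction of `H`, so `dim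
H ≤ dim F` (`IsConvexPolytope.exists_upper_face`); equality holds if `w` avoids the projections of
the faces of lower dimension. Moreover `H` passes close to `x` and is almost `u`-maximal, which
makes `F ↦ H` injective (`IsPolytopeFace.exists_close`).

For the maximum, `faceNumber_sum_le` bounds the face numbers of the sum by those of the summands; a
maximizer exists, and its perturbation is again one. -/

/-! ### Farkas' lemma and linear programming duality -/

/-- **Farkas' lemma** for a finite family of vectors. -/
theorem farkas_finset {ι X : Type*} [AddCommGroup X] [Module ℝ X] (s : Finset ι) (f : ι → X)
    (v : X) :
    (∃ c : ι → ℝ, (∀ i ∈ s, 0 ≤ c i) ∧ ∑ i ∈ s, c i • f i = v) ∨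
      ∃ g : Module.Dual ℝ X, (∀ i ∈ s, g (f i) ≤ 0) ∧ 0 < g v := by
  classical
  induction s using Finset.induction_on generalizing f v with
  | empty =>
    by_cases hv : v = 0
    · exact Or.inl ⟨0, by simp, by simp [hv]⟩
    · obtain ⟨g, hg⟩ := not_forall.1 (mt (Module.forall_dual_apply_eq_zero_iff ℝ v).1 hv)
      rcases lt_or_gt_of_ne hg with hg | hg
      · exact Or.inr ⟨-g, by simp, by simpa using hg⟩
      · exact Or.inr ⟨g, by simp, hg⟩
  | insert a s ha ih =>
    rcases ih f v with ⟨c, hc, hcv⟩ | ⟨g, hg, hgv⟩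
    · refine Or.inl ⟨Function.update c a 0, ?_, ?_⟩
      · intro i hi
        by_cases hia : i = a
        · simp [hia]
        · rw [Function.update_of_ne hia]
          exact hc i (Finset.mem_of_mem_insert_of_ne hi hia)
      · rw [Finset.sum_insert ha, ← hcv]
        simp only [Function.update_self, zero_smul, zero_add]
        refine Finset.sum_congr rfl fun i hi => ?_
        rw [Function.update_of_ne (by rintro rfl; exact ha hi)]
    · rcases le_or_gt (g (f a)) 0 with hga | hga
      · exact Or.inr ⟨g, by simpa [hga] using hg, hgv⟩
      · let p : X →ₗ[ℝ] X := LinearMap.id - (g.smulRight ((g (f a))⁻¹ • f a))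
        have hp : ∀ x, p x = x - (g x * (g (f a))⁻¹) • f a := fun x => by
          simp [p, smul_smul]
        rcases ih (fun i => p (f i)) (p v) with ⟨c, hc, hcv⟩ | ⟨h, hh, hhv⟩
        · refine Or.inl ⟨Function.update c a
            (g v * (g (f a))⁻¹ - ∑ i ∈ s, c i * (g (f i) * (g (f a))⁻¹)), ?_, ?_⟩
          · intro i hi
            by_cases hia : i = a
            · subst hia
              rw [Function.update_self, sub_nonneg]
              have : ∑ j ∈ s, c j * (g (f j) * (g (f i))⁻¹) ≤ 0 := by
                refine Finset.sum_nonpos fun j hj => ?_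
                exact mul_nonpos_of_nonneg_of_nonpos (hc j hj)
                  (mul_nonpos_of_nonpos_of_nonneg (hg j hj) (by positivity))
              exact this.trans (by positivity)
            · rw [Function.update_of_ne hia]
              exact hc i (Finset.mem_of_mem_insert_of_ne hi hia)
          · rw [Finset.sum_insert ha, Function.update_self]
            have : ∑ i ∈ s, Function.update c a
                (g v * (g (f a))⁻¹ - ∑ i ∈ s, c i * (g (f i) * (g (f a))⁻¹)) i • f i =
                ∑ i ∈ s, c i • f i := by
              refine Finset.sum_congr rfl fun i hi => ?_
              rw [Function.update_of_ne (by rintro rfl; exact ha hi)]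
            rw [this]
            simp only [hp, smul_sub, Finset.sum_sub_distrib, smul_smul, ← Finset.sum_smul] at hcv
            rw [sub_smul, ← sub_eq_zero]
            rw [← sub_eq_zero] at hcv
            rw [← hcv]
            abel
        · refine Or.inr ⟨h ∘ₗ p, ?_, hhv⟩
          intro i hi
          rcases Finset.mem_insert.1 hi with rfl | hi
          · simp [hp, hga.ne']
          · exact hh i hi

section Polytope

variable {E W : Type*} [AddCommGroup E] [Module ℝ E] [AddCommGroup W] [Module ℝ W]

theorem Module.Dual.le_on_convexHull (g : Module.Dual ℝ E) {s : Set E} {m : ℝ}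
    (h : ∀ v ∈ s, g v ≤ m) {x : E} (hx : x ∈ convexHull ℝ s) : g x ≤ m :=
  convexHull_min (t := {x | g x ≤ m}) h (convex_halfSpace_le g.isLinear m) hx

theorem Module.Dual.eq_on_convexHull (g : Module.Dual ℝ E) {s : Set E} {m : ℝ}
    (h : ∀ v ∈ s, g v = m) {x : E} (hx : x ∈ convexHull ℝ s) : g x = m :=
  convexHull_min (t := {x | g x = m}) h (convex_hyperplane g.isLinear m) hx

/-- A maximizer of a functional over a polytope is a convex combination of maximizing vertices. -/
theorem mem_convexHull_filter_of_eq (V : Finset E) (l : Module.Dual ℝ E) {m : ℝ}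
    (hm : ∀ v ∈ V, l v ≤ m) {x : E} (hx : x ∈ convexHull ℝ (V : Set E)) (hlx : l x = m) :
    x ∈ convexHull ℝ ((V.filter fun v => l v = m : Finset E) : Set E) := by
  rw [Finset.mem_convexHull'] at hx ⊢
  obtain ⟨w, hw0, hw1, rfl⟩ := hx
  have hz : ∀ v ∈ V, w v * (m - l v) = 0 := by
    rw [← Finset.sum_eq_zero_iff_of_nonneg
      (fun v hv => mul_nonneg (hw0 v hv) (sub_nonneg.2 (hm v hv)))]
    simp only [mul_sub, Finset.sum_sub_distrib, ← Finset.sum_mul, hw1]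
    rw [← hlx]
    simp
  have hz' : ∀ v ∈ V, ¬ l v = m → w v = 0 := fun v hv hne =>
    (mul_eq_zero.1 (hz v hv)).resolve_right (sub_ne_zero.2 (Ne.symm hne))
  refine ⟨w, fun v hv => hw0 v (Finset.mem_filter.1 hv).1, ?_, ?_⟩
  · rw [← hw1]
    exact Finset.sum_filter_of_ne fun v hv h => by_contra fun h' => h (hz' v hv h')
  · exact Finset.sum_filter_of_ne fun v hv h => by_contra fun h' => h (by rw [hz' v hv h', zero_smul])

/-- Directions in the cone spanned by `V - y` are feasible at the point `y` of `conv V`. -/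
theorem exists_pos_add_smul_mem_convexHull (V : Finset E) {y : E}
    (hy : y ∈ convexHull ℝ (V : Set E)) (c : E → ℝ) (hc : ∀ v ∈ V, 0 ≤ c v) :
    ∃ s : ℝ, 0 < s ∧ y + s • ∑ v ∈ V, c v • (v - y) ∈ convexHull ℝ (V : Set E) := by
  rcases (Finset.sum_nonneg hc).eq_or_lt' with h | h
  · refine ⟨1, one_pos, ?_⟩
    rw [Finset.sum_eq_zero_iff_of_nonneg hc] at h
    rw [Finset.sum_eq_zero fun v hv => by rw [h v hv, zero_smul]]
    simpa using hy
  · refine ⟨(∑ v ∈ V, c v)⁻¹, inv_pos.2 h, ?_⟩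
    have : y + (∑ v ∈ V, c v)⁻¹ • ∑ v ∈ V, c v • (v - y) = V.centerMass c id := by
      simp only [smul_sub, Finset.sum_sub_distrib, ← Finset.sum_smul, smul_smul,
        inv_mul_cancel₀ h.ne', one_smul, Finset.centerMass, id]
      abel
    rw [this]
    exact Finset.centerMass_mem_convexHull V hc h fun v hv => hv

/-- **Linear programming duality** over the fibres of a linear map on a polytope. -/
theorem exists_dual_of_isMax_fiber (V : Finset E) (p : E →ₗ[ℝ] W) (u : Module.Dual ℝ E) {y : E}
    (hy : y ∈ convexHull ℝ (V : Set E))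
    (hmax : ∀ q ∈ convexHull ℝ (V : Set E), p q = p y → u q ≤ u y) :
    ∃ t : Module.Dual ℝ W, ∀ q ∈ convexHull ℝ (V : Set E), u q + t (p q) ≤ u y + t (p y) := by
  -- A conic representation of `(0, 1)` would be a feasible direction at `y` that stays in the fibre
  -- and increases `u`. The alternative functional is positive on `(0, 1)`, and normalizing it there
  -- gives `t`.
  rcases farkas_finset V (fun v => (p (v - y), u (v - y))) ((0, 1) : W × ℝ) with
    ⟨c, hc, hcv⟩ | ⟨g, hg, hgv⟩
  · exfalso
    obtain ⟨s, hs, hmem⟩ := exists_pos_add_smul_mem_convexHull V hy c hc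
    have h1 : p (∑ v ∈ V, c v • (v - y)) = 0 := by
      have := congrArg Prod.fst hcv
      rw [Prod.fst_sum] at this
      simpa only [map_sum, map_smul, Prod.smul_fst] using this
    have h2 : u (∑ v ∈ V, c v • (v - y)) = 1 := by
      have := congrArg Prod.snd hcv
      rw [Prod.snd_sum] at this
      simpa only [map_sum, map_smul, Prod.smul_snd] using this
    have := hmax _ hmem (by rw [map_add, map_smul, h1, smul_zero, add_zero])
    rw [map_add, map_smul, h2, smul_eq_mul] at this
    linarith
  · have hsplit : ∀ a b, g (a, b) = g (a, 0) + b * g (0, 1) := fun a b => by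
      rw [← smul_eq_mul, ← map_smul, ← map_add]
      simp
    refine ⟨(g (0, 1))⁻¹ • (g ∘ₗ LinearMap.inl ℝ W ℝ), fun q hq => ?_⟩
    have key : ∀ v ∈ (V : Set E), (u + (g (0, 1))⁻¹ • (g ∘ₗ LinearMap.inl ℝ W ℝ) ∘ₗ p) v ≤
        u y + (g (0, 1))⁻¹ * g (p y, 0) := by
      intro v hv
      have h := hg v hv
      rw [hsplit, map_sub, map_sub] at h
      have h3 : g (p v - p y, 0) = g (p v, 0) - g (p y, 0) := by
        simp [← map_sub]
      rw [h3] at h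
      have h4 : (g (0, 1))⁻¹ * (g (p v, 0) - g (p y, 0) + (u v - u y) * g (0, 1)) ≤ 0 :=
        mul_nonpos_of_nonneg_of_nonpos (by positivity) h
      have h5 : (g (0, 1))⁻¹ * ((u v - u y) * g (0, 1)) = u v - u y := by
        field_simp
      simp only [LinearMap.add_apply, LinearMap.smul_apply, LinearMap.comp_apply,
        LinearMap.inl_apply, smul_eq_mul]
      rw [mul_add, h5, mul_sub] at h4
      linarith
    simpa using Module.Dual.le_on_convexHull _ key hq

/-- Every point `y` of a polytope lies in the relative interior of a face. -/
theorem exists_dual_relint (V : Finset E) {y : E} (hy : y ∈ convexHull ℝ (V : Set E)) :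
    ∃ l : Module.Dual ℝ E, (∀ q ∈ convexHull ℝ (V : Set E), l q ≤ l y) ∧
      ∀ h ∈ convexHull ℝ (V : Set E), l h = l y →
        ∃ s : ℝ, 0 < s ∧ y - s • (h - y) ∈ convexHull ℝ (V : Set E) := by
  classical
  let N : Set (Module.Dual ℝ E) := {l | ∀ q ∈ convexHull ℝ (V : Set E), l q ≤ l y}
  -- Among the functionals maximal at `y`, take one with the fewest maximizing points of `V`. If no
  -- move from `y` away from `h` were feasible, adding the Farkas functional `g` would leave fewer:
  -- otherwise `g` is constant on the face exposed by `l`, against `0 < g (y - h)`.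
  obtain ⟨l, hl, hmin⟩ := exists_minimalFor_of_wellFoundedLT (fun l => l ∈ N)
    (fun l : Module.Dual ℝ E => (V.filter fun v => l v = l y).card) ⟨0, by simp [N]⟩
  refine ⟨l, hl, fun h hh hlh => ?_⟩
  rcases farkas_finset V (fun v => v - y) (y - h) with ⟨c, hc, hcv⟩ | ⟨g, hg, hgv⟩
  · obtain ⟨s, hs, hmem⟩ := exists_pos_add_smul_mem_convexHull V hy c hc
    refine ⟨s, hs, ?_⟩
    rw [hcv] at hmem
    rwa [sub_eq_add_neg, ← smul_neg, neg_sub]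
  · exfalso
    have hV : ∀ v ∈ V, v ∈ convexHull ℝ (V : Set E) := fun v hv => subset_convexHull ℝ _ hv
    have hgV : ∀ v ∈ V, g v ≤ g y := fun v hv => by
      have := hg v hv
      rw [map_sub] at this
      linarith
    have hgN : g ∈ N := fun q hq => g.le_on_convexHull hgV hq
    have hlg : l + g ∈ N := fun q hq => add_le_add (hl q hq) (hgN q hq)
    have hsub : (V.filter fun v => (l + g) v = (l + g) y) ⊆ V.filter fun v => l v = l y := by
      intro v hv
      rw [Finset.mem_filter] at hv ⊢
      refine ⟨hv.1, ?_⟩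
      have h1 := hl v (hV v hv.1)
      have h2 := hgV v hv.1
      have h3 := hv.2
      simp only [LinearMap.add_apply] at h3
      linarith
    have heq := Finset.eq_of_subset_of_card_le hsub (hmin hlg (Finset.card_le_card hsub))
    have hx := mem_convexHull_filter_of_eq V l (fun v hv => hl v (hV v hv)) hh hlh
    have := g.eq_on_convexHull (m := g y) (fun v hv => ?_) hx
    · rw [map_sub] at hgv
      linarith
    · rw [← heq] at hv
      have hv' := (Finset.mem_filter.1 hv)
      have h3 := hv'.2
      rw [heq] at hv
      have h4 := (Finset.mem_filter.1 hv).2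
      simp only [LinearMap.add_apply] at h3
      linarith

end Polytope

/-! ### Directions and finiteness of faces -/

theorem Module.finrank_le_of_forall_eq_zero {E W : Type*} [AddCommGroup E] [Module ℝ E]
    [AddCommGroup W] [Module ℝ W] [FiniteDimensional ℝ W] (p : E →ₗ[ℝ] W) (D : Submodule ℝ E)
    (h : ∀ v ∈ D, p v = 0 → v = 0) : Module.finrank ℝ D ≤ Module.finrank ℝ W := by
  refine LinearMap.finrank_le_finrank_of_injective (f := p ∘ₗ D.subtype) ?_
  rw [← LinearMap.ker_eq_bot, LinearMap.ker_eq_bot']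
  rintro ⟨v, hv⟩ hv0
  exact Subtype.ext (h v hv hv0)

/-- If a convex set `Q` extends beyond `y` in each direction of `H - y`, then it does so in each
direction of the linear span. -/
theorem exists_pos_of_mem_vectorSpan {E : Type*} [AddCommGroup E] [Module ℝ E] {Q H : Set E}
    (hQ : Convex ℝ Q) {y : E} (hyH : y ∈ H) (hHQ : H ⊆ Q)
    (h : ∀ x ∈ H, ∃ s : ℝ, 0 < s ∧ y - s • (x - y) ∈ Q) {v : E} (hv : v ∈ vectorSpan ℝ H) :
    ∃ s : ℝ, 0 < s ∧ y + s • v ∈ Q ∧ y - s • v ∈ Q := by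
  have hyQ := hHQ hyH
  have shrink : ∀ {v : E} {s t : ℝ}, 0 < t → t ≤ s → y + s • v ∈ Q → y + t • v ∈ Q := by
    intro v s t ht hts hs
    have hs0 : 0 < s := ht.trans_le hts
    have := hQ.add_smul_mem hyQ hs (t := t / s) ⟨by positivity, by rwa [div_le_one hs0]⟩
    rwa [smul_smul, div_mul_cancel₀ _ hs0.ne'] at this
  rw [vectorSpan_eq_span_vsub_set_right ℝ hyH] at hv
  induction hv using Submodule.span_induction with
  | mem v hv =>
    obtain ⟨x, hx, rfl⟩ := hv
    obtain ⟨s, hs, hmem⟩ := h x hx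
    simp only [vsub_eq_sub]
    refine ⟨min s 1, lt_min hs one_pos, ?_, ?_⟩
    · refine shrink (s := 1) (lt_min hs one_pos) (min_le_right _ _) ?_
      simpa using hHQ hx
    · rw [sub_eq_add_neg, ← smul_neg]
      refine shrink (s := s) (lt_min hs one_pos) (min_le_left _ _) ?_
      rwa [smul_neg, ← sub_eq_add_neg]
  | zero => exact ⟨1, one_pos, by simpa, by simpa⟩
  | add v w _ _ hv hw =>
    obtain ⟨s, hs, hs1, hs2⟩ := hv
    obtain ⟨t, ht, ht1, ht2⟩ := hw
    have hm := lt_min hs ht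
    rw [sub_eq_add_neg, ← smul_neg] at hs2 ht2
    refine ⟨min s t / 2, by positivity, ?_, ?_⟩
    · convert! hQ.midpoint_mem (shrink hm (min_le_left _ _) hs1) (shrink hm (min_le_right _ _) ht1)
        using 1
      rw [midpoint_eq_smul_add, invOf_eq_inv]
      module
    · convert! hQ.midpoint_mem (shrink hm (min_le_left _ _) hs2) (shrink hm (min_le_right _ _) ht2)
        using 1
      rw [midpoint_eq_smul_add, invOf_eq_inv]
      module
  | smul a v _ hv =>
    obtain ⟨s, hs, hs1, hs2⟩ := hv
    rcases lt_trichotomy a 0 with ha | rfl | ha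
    · refine ⟨s / (-a), div_pos hs (neg_pos.2 ha), ?_, ?_⟩
      · convert hs2 using 1
        rw [smul_smul, show s / -a * a = -s by rw [div_neg, neg_mul, div_mul_cancel₀ _ ha.ne]]
        module
      · convert hs1 using 1
        rw [smul_smul, show s / -a * a = -s by rw [div_neg, neg_mul, div_mul_cancel₀ _ ha.ne]]
        module
    · exact ⟨1, one_pos, by simpa, by simpa⟩
    · refine ⟨s / a, by positivity, ?_, ?_⟩
      · rwa [smul_smul, div_mul_cancel₀ _ ha.ne']
      · rwa [smul_smul, div_mul_cancel₀ _ ha.ne']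

theorem IsConvexPolytope.nonempty {E : Type*} [AddCommGroup E] [Module ℝ E] {P : Set E}
    (hP : IsConvexPolytope P) : P.Nonempty := by
  obtain ⟨s, hs, rfl⟩ := hP
  exact Set.Nonempty.convexHull hs

theorem IsConvexPolytope.convex {E : Type*} [AddCommGroup E] [Module ℝ E] {P : Set E}
    (hP : IsConvexPolytope P) : Convex ℝ P := by
  obtain ⟨s, hs, rfl⟩ := hP
  exact convex_convexHull ℝ _

theorem IsConvexPolytope.isCompact {E : Type*} [NormedAddCommGroup E] [NormedSpace ℝ E] {P : Set E} (hP : IsConvexPolytope P) : IsCompact P := by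
  obtain ⟨s, -, rfl⟩ := hP
  exact s.finite_toSet.isCompact_convexHull ℝ

/-- A polytope has finitely many faces. -/
theorem IsConvexPolytope.finite_faces {E : Type*} [NormedAddCommGroup E] [NormedSpace ℝ E] {P : Set E} (hP : IsConvexPolytope P) :
    {F | IsPolytopeFace P F}.Finite := by
  classical
  obtain ⟨V, -, rfl⟩ := hP
  refine (V.powerset.finite_toSet.image fun s : Finset E => convexHull ℝ (s : Set E)).subset ?_
  intro F hF
  rcases F.eq_empty_or_nonempty with rfl | hne
  · exact ⟨∅, by simp, by simp⟩
  obtain ⟨l, rfl⟩ := hF hne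
  obtain ⟨x, hx, hmax⟩ := hne
  refine ⟨V.filter fun v => l v = l x, Finset.mem_coe.2 (Finset.mem_powerset.2 (Finset.filter_subset _ _)), ?_⟩
  refine Set.Subset.antisymm ?_ ?_
  · intro q hq
    have h1 : l q = l x := Module.Dual.eq_on_convexHull (l : Module.Dual ℝ E)
      (fun v hv => (Finset.mem_filter.1 hv).2) hq
    refine ⟨convexHull_mono (Finset.coe_subset.2 (Finset.filter_subset _ _)) hq, fun z hz => ?_⟩
    rw [h1]
    exact hmax z hz
  · rintro q ⟨hq, hq'⟩
    exact mem_convexHull_filter_of_eq V (l : Module.Dual ℝ E)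
      (fun v hv => hmax v (subset_convexHull ℝ _ hv)) hq (le_antisymm (hmax q hq) (hq' x hx))

/-! ### Upper faces over a linear projection -/

section

variable {E W : Type*} [NormedAddCommGroup E] [NormedSpace ℝ E] [FiniteDimensional ℝ E]
  [NormedAddCommGroup W] [NormedSpace ℝ W] [FiniteDimensional ℝ W]

/-- Over each point `w` of the image of a polytope under a linear map, a polytope has an
upper face (with respect to `u`) whose dimension is at most the dimension of the target. -/
theorem IsConvexPolytope.exists_upper_face {Q : Set E} (hQ : IsConvexPolytope Q)
    (p : E →L[ℝ] W) (u : StrongDual ℝ E) {w : W} (hw : w ∈ p '' Q) :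
    ∃ (y : E) (H : Set E) (t : StrongDual ℝ W), p y = w ∧ IsPolytopeFace Q H ∧ y ∈ H ∧
      Module.finrank ℝ (vectorSpan ℝ H) ≤ Module.finrank ℝ W ∧
      ∀ h ∈ H, ∀ q ∈ Q, u q + t (p q) ≤ u h + t (p h) := by
  obtain ⟨V, -, rfl⟩ := id hQ
  set Q := convexHull ℝ (V : Set E) with hQdef
  obtain ⟨x, hxQ, hxw⟩ := hw
  have hKc : IsCompact (Q ∩ p ⁻¹' {w}) :=
    hQ.isCompact.inter_right (isClosed_singleton.preimage p.continuous)
  have hexp : IsExposed ℝ (Q ∩ p ⁻¹' {w}) (u.toExposed (Q ∩ p ⁻¹' {w})) :=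
    ContinuousLinearMap.toExposed.isExposed
  have hMne : (u.toExposed (Q ∩ p ⁻¹' {w})).Nonempty := by
    obtain ⟨z, hz, hz'⟩ := hKc.exists_isMaxOn ⟨x, hxQ, hxw⟩ u.continuous.continuousOn
    exact ⟨z, hz, fun y hy => hz' hy⟩
  -- Extremality gives the dimension bound: if `v` is a direction of `H` killed by `p`, then `y ± s
  -- • v` are both `u`-maximal in the fibre with midpoint `y`, so `v = 0`.
  obtain ⟨y, hy⟩ := (hexp.isCompact hKc).extremePoints_nonempty hMne
  obtain ⟨⟨hyQ, hyw⟩, hymax⟩ := hy.1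
  obtain ⟨l, hl, hl'⟩ := exists_dual_relint V hyQ
  obtain ⟨t, ht⟩ := exists_dual_of_isMax_fiber V (p : E →ₗ[ℝ] W) (u : Module.Dual ℝ E) hyQ
    (fun q hq hqy => hymax q ⟨hq, hqy.trans hyw⟩)
  let L : StrongDual ℝ E := LinearMap.toContinuousLinearMap l
  have hyH : y ∈ L.toExposed Q := ⟨hyQ, hl⟩
  have hH : ∀ h ∈ L.toExposed Q, ∃ s : ℝ, 0 < s ∧ y - s • (h - y) ∈ Q := fun h hh =>
    hl' h hh.1 (le_antisymm (hl h hh.1) (hh.2 y hyQ))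
  refine ⟨y, L.toExposed Q, LinearMap.toContinuousLinearMap t, hyw,
    ContinuousLinearMap.toExposed.isExposed, hyH, ?_, ?_⟩
  · refine Module.finrank_le_of_forall_eq_zero (p : E →ₗ[ℝ] W) _ fun v hv hpv => ?_
    obtain ⟨s, hs, h1, h2⟩ := exists_pos_of_mem_vectorSpan hQ.convex hyH (fun _ h => h.1) hH hv
    have hpv : p v = 0 := hpv
    have k1 : y + s • v ∈ Q ∩ p ⁻¹' {w} :=
      ⟨h1, by simp [hpv, Set.mem_singleton_iff.1 hyw]⟩
    have k2 : y - s • v ∈ Q ∩ p ⁻¹' {w} :=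
      ⟨h2, by simp [hpv, Set.mem_singleton_iff.1 hyw]⟩
    have m1 := hymax _ k1
    have m2 := hymax _ k2
    rw [map_add, map_smul, smul_eq_mul] at m1
    rw [map_sub, map_smul, smul_eq_mul] at m2
    have hz : s * u v = 0 := by linarith
    have e1 : y + s • v ∈ u.toExposed (Q ∩ p ⁻¹' {w}) := ⟨k1, fun z hz' => by
      rw [map_add, map_smul, smul_eq_mul, hz, add_zero]; exact hymax z hz'⟩
    have e2 : y - s • v ∈ u.toExposed (Q ∩ p ⁻¹' {w}) := ⟨k2, fun z hz' => by
      rw [map_sub, map_smul, smul_eq_mul, hz, sub_zero]; exact hymax z hz'⟩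
    have := hy.2 e1 e2 ⟨1 / 2, 1 / 2, by norm_num, by norm_num, by norm_num, by module⟩
    have hsv : s • v = 0 := by simpa using this
    exact (smul_eq_zero.1 hsv).resolve_left hs.ne'
  -- `u + t ∘ p` is maximal at `y`; as `H` extends beyond `y` on the side opposite to `h`, its value
  -- at `h` cannot be smaller.
  · intro h hh q hq
    obtain ⟨s, hs, hmem⟩ := hH h hh
    have h1 := ht _ hmem
    have h2 := ht q hq
    simp only [map_sub, map_smul, smul_eq_mul, ContinuousLinearMap.coe_coe] at h1 h2
    have h3 : s * (u y + t (p y) - (u h + t (p h))) ≤ 0 := by linarith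
    have h4 := nonpos_of_mul_nonpos_right h3 hs
    simp only [LinearMap.coe_toContinuousLinearMap']
    linarith

/-- A ball is not covered by finitely many sets of positive codimension. -/
theorem exists_mem_ball_notMem_of_finrank_vectorSpan_lt {S : Set (Set W)} (hS : S.Finite)
    (hdim : ∀ G ∈ S, Module.finrank ℝ (vectorSpan ℝ G) < Module.finrank ℝ W) (w : W) {r : ℝ}
    (hr : 0 < r) : ∃ w' ∈ Metric.ball w r, ∀ G ∈ S, w' ∉ G := by
  borelize W
  let μ : MeasureTheory.Measure W := MeasureTheory.Measure.addHaar
  have h0 : μ (⋃ G ∈ S, G) = 0 := by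
    rw [MeasureTheory.measure_biUnion_null_iff hS.countable]
    intro G hG
    refine MeasureTheory.measure_mono_null (subset_affineSpan ℝ G)
      (MeasureTheory.Measure.addHaar_affineSubspace μ _ fun h => ?_)
    have := hdim G hG
    rw [← direction_affineSpan, h, AffineSubspace.direction_top, finrank_top] at this
    exact lt_irrefl _ this
  have hpos : 0 < μ (Metric.ball w r) := Metric.measure_ball_pos μ w hr
  by_contra! hcon
  refine hpos.ne' (MeasureTheory.measure_mono_null (fun x hx => ?_) h0)
  obtain ⟨G, hG, hxG⟩ := hcon x hx
  exact Set.mem_biUnion hG hxG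

end

theorem ContinuousLinearMap.vectorSpan_image {E W : Type*} [NormedAddCommGroup E]
    [NormedSpace ℝ E] [NormedAddCommGroup W] [NormedSpace ℝ W] (p : E →L[ℝ] W) (s : Set E) :
    vectorSpan ℝ (p '' s) = (vectorSpan ℝ s).map (p : E →ₗ[ℝ] W) :=
  ((p : E →ₗ[ℝ] W).toAffineMap.map_vectorSpan (s := s)).symm

/-! ### Estimates for polytopes close to a given one -/

/-- Compactness: points of `P` that almost maximize `u` and almost have the image of `x` are close
to `x`. -/
theorem IsCompact.exists_forall_dist_lt {E W : Type*} [NormedAddCommGroup E] [NormedSpace ℝ E]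
    [NormedAddCommGroup W] [NormedSpace ℝ W] {P : Set E} (hP : IsCompact P)
    (p : E →L[ℝ] W) (u : StrongDual ℝ E) {x : E}
    (hu : ∀ q ∈ P, u q ≤ u x) (hx : ∀ q ∈ P, u q = u x → p q = p x → q = x)
    {ε : ℝ} (hε : 0 < ε) :
    ∃ η > 0, ∀ q ∈ P, u x - η ≤ u q → dist (p q) (p x) ≤ η → dist q x < ε := by
  have hK : IsCompact (P ∩ {q | ε ≤ dist q x}) :=
    hP.inter_right (isClosed_le continuous_const (continuous_id.dist continuous_const))
  let f : E → ℝ := fun q => max (u x - u q) (dist (p q) (p x))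
  have hf : Continuous f := by fun_prop
  rcases (P ∩ {q | ε ≤ dist q x}).eq_empty_or_nonempty with h | h
  · refine ⟨1, one_pos, fun q hq _ _ => ?_⟩
    by_contra! hc
    exact Set.notMem_empty q (h ▸ ⟨hq, hc⟩)
  · obtain ⟨z, ⟨hzP, hz⟩, hmin⟩ := hK.exists_isMinOn h hf.continuousOn
    have hfz : 0 < f z := by
      rw [lt_max_iff]
      by_contra! hc
      have h1 : u z = u x := le_antisymm (hu z hzP) (by linarith [hc.1])
      have h2 : p z = p x := dist_le_zero.1 hc.2
      have := hx z hzP h1 h2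
      subst this
      simp only [Set.mem_ofPred_eq, dist_self] at hz
      linarith
    refine ⟨f z / 2, by positivity, fun q hq h1 h2 => ?_⟩
    by_contra! hc
    have h3 : f z ≤ f q := hmin ⟨hq, hc⟩
    have h4 : f q ≤ f z / 2 := max_le (by linarith) h2
    linarith

/-- If the `u`-maximal points of `P` project onto a ball around `w`, then so does every set
close to `P`, at least onto the center `w`. -/
theorem mem_image_of_close {E W : Type*} [NormedAddCommGroup E] [NormedSpace ℝ E]
    [NormedAddCommGroup W] [NormedSpace ℝ W] {P Q : Set E} (hQ : IsCompact Q) (hQc : Convex ℝ Q)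
    (hQne : Q.Nonempty) (p : E →L[ℝ] W) {w : W} {ρ δ : ℝ} (hρ : 0 < ρ)
    (hball : ∀ z ∈ Metric.closedBall (0 : W) ρ, ∃ f ∈ P, p f = w + z)
    (hPQ : ∀ f ∈ P, ∃ q ∈ Q, dist f q ≤ δ) (hδ : ‖p‖ * δ ≤ ρ / 2) : w ∈ p '' Q := by
  by_contra hw
  -- A functional separating `w` from `p '' Q` is at most `‖t‖ * (ρ / 2)` on the ball of radius `ρ`,
  -- so it vanishes and separates nothing.
  obtain ⟨t, a, hta, hat⟩ := geometric_hahn_banach_closed_point (s := p '' Q) (x := w)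
    (hQc.is_linear_image p.toLinearMap.isLinear) (hQ.image p.continuous).isClosed hw
  have key : ∀ z ∈ Metric.closedBall (0 : W) ρ, t z ≤ ‖t‖ * (ρ / 2) := by
    intro z hz
    obtain ⟨f, hf, hfz⟩ := hball z hz
    obtain ⟨q, hq, hfq⟩ := hPQ f hf
    have h1 : t (p q) < t w := (hta _ ⟨q, hq, rfl⟩).trans hat
    have h2 : t (p (f - q)) ≤ ‖t‖ * (ρ / 2) := by
      refine (le_abs_self _).trans ((t.le_opNorm _).trans ?_)
      refine mul_le_mul_of_nonneg_left ((p.le_opNorm _).trans ?_) (norm_nonneg _)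
      rw [dist_eq_norm] at hfq
      exact (mul_le_mul_of_nonneg_left hfq (norm_nonneg _)).trans hδ
    rw [map_sub, map_sub, hfz, map_add] at h2
    linarith
  have hn : ‖t‖ ≤ ‖t‖ * (ρ / 2) / ρ := ContinuousLinearMap.opNorm_bound_of_ball_bound hρ _ t
    fun z hz => abs_le.2 ⟨by
      have := key (-z) (by simpa using hz)
      rw [map_neg] at this
      linarith, key z hz⟩
  have h0 : ‖t‖ = 0 := by
    have : ‖t‖ * (ρ / 2) / ρ = ‖t‖ / 2 := by field_simp
    linarith [norm_nonneg t]
  rw [norm_eq_zero] at h0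
  obtain ⟨q, hq⟩ := hQne
  have := (hta _ ⟨q, hq, rfl⟩).trans hat
  simp [h0] at this

section

variable {E W : Type*} [NormedAddCommGroup E] [NormedSpace ℝ E] [FiniteDimensional ℝ E]
  [NormedAddCommGroup W] [NormedSpace ℝ W] [FiniteDimensional ℝ W]

/-- Quantitative version of `IsConvexPolytope.exists_upper_face` for polytopes close to `P`: the
upper face is almost `u`-maximal. -/
theorem exists_upper_face_of_close {P : Set E} (hP : IsCompact P) (p : E →L[ℝ] W)
    (u : StrongDual ℝ E) {M ρ : ℝ} (hρ : 0 < ρ) (hM : ∀ f ∈ P, u f ≤ M) :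
    ∃ K ≥ 0, ∃ δ₀ > 0, ∀ δ ≤ δ₀, ∀ (w : W) (Q : Set E), IsConvexPolytope Q →
      (∀ z ∈ Metric.closedBall (0 : W) ρ, ∃ f ∈ P, p f = w + z ∧ u f = M) →
      (∀ f ∈ P, ∃ q ∈ Q, dist f q ≤ δ) → (∀ q ∈ Q, ∃ f ∈ P, dist q f ≤ δ) →
      ∃ (y : E) (H : Set E), p y = w ∧ IsPolytopeFace Q H ∧ y ∈ H ∧
        Module.finrank ℝ (vectorSpan ℝ H) ≤ Module.finrank ℝ W ∧
        ∀ h ∈ H, M - K * δ ≤ u h := by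
  -- The loss in `u` is `‖u‖ * δ` for passing from `P` to `Q`, plus the variation of `t ∘ p` along
  -- `H`, where `‖t‖ ≤ 4 * ‖u‖ / ρ * δ`.
  refine ⟨‖u‖ + 4 * ‖u‖ / ρ * (‖p‖ * (Metric.diam P + 2)), by positivity,
    min 1 (ρ / (2 * (‖p‖ + 1))), by positivity, fun δ hδ w Q hQ hball hPQ hQP => ?_⟩
  have hδ1 : δ ≤ 1 := hδ.trans (min_le_left _ _)
  have hδ0 : 0 ≤ δ := by
    obtain ⟨q, hq⟩ := hQ.nonempty
    obtain ⟨f, -, hf⟩ := hQP q hq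
    exact dist_nonneg.trans hf
  have hδ2 : ‖p‖ * δ ≤ ρ / 2 := by
    have h1 : δ ≤ ρ / (2 * (‖p‖ + 1)) := hδ.trans (min_le_right _ _)
    rw [le_div_iff₀ (by positivity)] at h1
    nlinarith [norm_nonneg p]
  have hw : w ∈ p '' Q := mem_image_of_close hQ.isCompact hQ.convex hQ.nonempty p hρ
    (fun z hz => (hball z hz).imp fun f hf => ⟨hf.1, hf.2.1⟩) hPQ hδ2
  obtain ⟨y, H, t, hyw, hH, hyH, hdim, hmax⟩ := hQ.exists_upper_face p u hw
  have hu : ∀ a b : E, dist a b ≤ δ → u a - ‖u‖ * δ ≤ u b := by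
    intro a b hab
    have h1 : u (a - b) ≤ ‖u‖ * δ := (le_abs_self _).trans ((u.le_opNorm _).trans
      (mul_le_mul_of_nonneg_left (by rwa [← dist_eq_norm]) (norm_nonneg _)))
    rw [map_sub] at h1
    linarith
  have htp : ∀ (v : E) (D : ℝ), ‖v‖ ≤ D → t (p v) ≤ ‖t‖ * (‖p‖ * D) := by
    intro v D hD
    refine (le_abs_self _).trans ((t.le_opNorm _).trans ?_)
    exact mul_le_mul_of_nonneg_left ((p.le_opNorm _).trans
      (mul_le_mul_of_nonneg_left hD (norm_nonneg _))) (norm_nonneg _)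
  have huy : u y ≤ M + ‖u‖ * δ := by
    obtain ⟨f, hf, hyf⟩ := hQP y (hH.subset hyH)
    have := hu y f hyf
    linarith [hM f hf]
  -- The tilt `t` is small because `P` reaches the height `M` over the whole ball around `w`, while
  -- `Q` is at most `‖u‖ * δ` higher at `y`.
  have key : ∀ z ∈ Metric.closedBall (0 : W) ρ, t z ≤ 2 * ‖u‖ * δ + ‖t‖ * (ρ / 2) := by
    intro z hz
    obtain ⟨f, hf, hfz, hfM⟩ := hball z hz
    obtain ⟨q, hq, hfq⟩ := hPQ f hf
    have h1 := hmax y hyH q hq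
    have h2 := htp (f - q) δ (by rwa [← dist_eq_norm])
    have h3 := hu f q hfq
    have h4 : ‖t‖ * (‖p‖ * δ) ≤ ‖t‖ * (ρ / 2) := mul_le_mul_of_nonneg_left hδ2 (norm_nonneg _)
    rw [map_sub, map_sub, hfz, map_add] at h2
    rw [hyw] at h1
    linarith
  have hn : ‖t‖ ≤ (2 * ‖u‖ * δ + ‖t‖ * (ρ / 2)) / ρ :=
    ContinuousLinearMap.opNorm_bound_of_ball_bound hρ _ t
    fun z hz => abs_le.2 ⟨by
      have := key (-z) (by simpa using hz)
      rw [map_neg] at this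
      linarith, key z hz⟩
  have hn' : ‖t‖ ≤ 4 * ‖u‖ / ρ * δ := by
    rw [le_div_iff₀ hρ] at hn
    rw [div_mul_eq_mul_div, le_div_iff₀ hρ]
    linarith
  refine ⟨y, H, hyw, hH, hyH, hdim, fun h hh => ?_⟩
  obtain ⟨f, hf, -, hfM⟩ := hball 0 (Metric.mem_closedBall_self hρ.le)
  obtain ⟨q, hq, hfq⟩ := hPQ f hf
  obtain ⟨f', hf', hhf'⟩ := hQP h (hH.subset hh)
  have h1 := hmax h hh q hq
  have h2 : ‖h - q‖ ≤ Metric.diam P + 2 := by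
    rw [← dist_eq_norm]
    have := Metric.dist_le_diam_of_mem hP.isBounded hf' hf
    linarith [dist_triangle4 h f' f q]
  have h3 := htp _ _ h2
  have h4 := hu f q hfq
  have h5 : ‖t‖ * (‖p‖ * (Metric.diam P + 2)) ≤
      4 * ‖u‖ / ρ * δ * (‖p‖ * (Metric.diam P + 2)) :=
    mul_le_mul_of_nonneg_right hn' (by positivity)
  rw [map_sub, map_sub] at h3
  linarith

end

/-! ### Approximating one face -/

section

variable {E : Type*} [NormedAddCommGroup E] [InnerProductSpace ℝ E] [FiniteDimensional ℝ E]

/-- The projection of `F` spans the whole direction space, and a convex set with full affine hull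
has interior. The ball encodes that `x` is a relative interior point of `F`. -/
theorem Convex.exists_closedBall_subset_image_orthogonalProjectionOnto {F : Set E} (hF : Convex ℝ F)
    (hne : F.Nonempty) :
    ∃ x ∈ F, ∃ ρ > 0, Metric.closedBall ((vectorSpan ℝ F).orthogonalProjectionOnto x) ρ ⊆
      (vectorSpan ℝ F).orthogonalProjectionOnto '' F := by
  set p := (vectorSpan ℝ F).orthogonalProjectionOnto
  have hspan : vectorSpan ℝ (p '' F) = ⊤ := by
    rw [ContinuousLinearMap.vectorSpan_image, eq_top_iff]
    intro v _
    exact ⟨v, v.2, (vectorSpan ℝ F).orthogonalProjectionOnto_mem_subspace_eq_self v⟩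
  have himg : Convex ℝ (p '' F) := hF.is_linear_image p.toLinearMap.isLinear
  have hint : (interior (p '' F)).Nonempty := by
    rw [himg.interior_nonempty_iff_affineSpan_eq_top,
      AffineSubspace.affineSpan_eq_top_iff_vectorSpan_eq_top_of_nonempty ℝ _ _ (hne.image _)]
    exact hspan
  obtain ⟨z, hz⟩ := hint
  obtain ⟨x, hx, rfl⟩ := interior_subset hz
  obtain ⟨ρ, hρ, hball⟩ := Metric.nhds_basis_closedBall.mem_iff.1 (mem_interior_iff_mem_nhds.1 hz)
  exact ⟨x, hx, ρ, hρ, hball⟩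

theorem eq_of_mem_of_orthogonalProjectionOnto_eq {F : Set E} {x y : E} (hx : x ∈ F) (hy : y ∈ F)
    (h : (vectorSpan ℝ F).orthogonalProjectionOnto x = (vectorSpan ℝ F).orthogonalProjectionOnto y) :
    x = y := by
  have h1 : x - y ∈ vectorSpan ℝ F := vsub_mem_vectorSpan ℝ hx hy
  have h2 := (vectorSpan ℝ F).orthogonalProjectionOnto_mem_subspace_eq_self ⟨x - y, h1⟩
  rw [map_sub, h, sub_self] at h2
  exact sub_eq_zero.1 (congrArg Subtype.val h2).symm

/-- A face containing a relative interior point of `F` contains `F`. -/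
theorem IsPolytopeFace.subset_of_mem {P F G : Set E} (hFP : F ⊆ P) (hG : IsPolytopeFace P G)
    {x : E} (hxF : x ∈ F) (hxG : x ∈ G) {ρ : ℝ} (hρ : 0 < ρ)
    (hball : Metric.closedBall ((vectorSpan ℝ F).orthogonalProjectionOnto x) ρ ⊆
      (vectorSpan ℝ F).orthogonalProjectionOnto '' F) : F ⊆ G := by
  set p := (vectorSpan ℝ F).orthogonalProjectionOnto with hp
  obtain ⟨g, rfl⟩ := hG ⟨x, hxG⟩
  intro f hf
  refine ⟨hFP hf, fun y hy => (hxG.2 y hy).trans ?_⟩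
  have hs : 0 < ρ / (‖p (f - x)‖ + 1) := by positivity
  set s := ρ / (‖p (f - x)‖ + 1) with hsdef
  -- The ball provides `f' = x - s • (f - x)` in `F`. Since `g` is maximal at `x`, it does not
  -- increase towards `f'`, so `g f` is at least `g x`.
  have hmem : p x - s • p (f - x) ∈ Metric.closedBall (p x) ρ := by
    rw [mem_closedBall_iff_norm, sub_sub_cancel_left, norm_neg, norm_smul, Real.norm_of_nonneg hs.le,
      hsdef, div_mul_eq_mul_div, div_le_iff₀ (by positivity)]
    nlinarith [norm_nonneg (p (f - x))]
  obtain ⟨f', hf', hpf'⟩ := hball hmem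
  have h1 : f' - x + s • (f - x) ∈ vectorSpan ℝ F :=
    add_mem (vsub_mem_vectorSpan ℝ hf' hxF) (Submodule.smul_mem _ _ (vsub_mem_vectorSpan ℝ hf hxF))
  have h2 := (vectorSpan ℝ F).orthogonalProjectionOnto_mem_subspace_eq_self ⟨_, h1⟩
  rw [← hp, map_add, map_sub, hpf', map_smul, sub_sub_cancel_left, neg_add_cancel] at h2
  have h3 : f' - x + s • (f - x) = 0 := (congrArg Subtype.val h2).symm
  have h4 : g (f' - x + s • (f - x)) = 0 := by rw [h3, map_zero]
  rw [map_add, map_smul, map_sub, map_sub, smul_eq_mul] at h4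
  have h5 := hxG.2 f' (hFP hf')
  have h6 : 0 ≤ s * (g f - g x) := by linarith
  have := nonneg_of_mul_nonneg_right h6 hs
  linarith

/-- A face `F` of a polytope `P` is approximated by faces of the same dimension of the
polytopes close to `P`. -/
theorem IsPolytopeFace.exists_close {P F : Set E} (hP : IsConvexPolytope P)
    (hF : IsPolytopeFace P F) (hne : F.Nonempty) :
    ∃ x ∈ F, ∃ u : StrongDual ℝ E, F = u.toExposed P ∧
      (∀ G, IsPolytopeFace P G → x ∈ G → F ⊆ G) ∧
      ∀ ε > 0, ∃ δ₀ > 0, ∀ δ ≤ δ₀, ∀ Q, IsConvexPolytope Q →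
        (∀ f ∈ P, ∃ q ∈ Q, dist f q ≤ δ) → (∀ q ∈ Q, ∃ f ∈ P, dist q f ≤ δ) →
        ∃ H, IsPolytopeFace Q H ∧ H.Nonempty ∧
          Module.finrank ℝ (vectorSpan ℝ H) = Module.finrank ℝ (vectorSpan ℝ F) ∧
          (∃ y ∈ H, dist y x < ε) ∧ ∀ h ∈ H, u x - ε < u h := by
  have hconv : Convex ℝ F := IsExposed.convex hF hP.convex
  obtain ⟨x, hxF, ρ, hρ, hball⟩ :=
    hconv.exists_closedBall_subset_image_orthogonalProjectionOnto hne
  obtain ⟨u, hFu⟩ := hF hne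
  refine ⟨x, hxF, u, hFu, fun G hG hxG => hG.subset_of_mem hF.subset hxF hxG hρ hball,
    fun ε hε => ?_⟩
  have hux : ∀ q ∈ P, u q ≤ u x := by
    rw [hFu] at hxF
    exact hxF.2
  have huF : ∀ f ∈ F, u f = u x := fun f hf =>
    le_antisymm (hux f (hF.subset hf)) (by rw [hFu] at hf; exact hf.2 x (hF.subset hxF))
  set p := (vectorSpan ℝ F).orthogonalProjectionOnto with hp
  obtain ⟨η, hη, hη'⟩ := hP.isCompact.exists_forall_dist_lt p u hux (fun q hq h1 h2 => by
    refine eq_of_mem_of_orthogonalProjectionOnto_eq (F := F) ?_ hxF h2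
    rw [hFu]
    exact ⟨hq, fun z hz => h1 ▸ hux z hz⟩) (half_pos hε)
  obtain ⟨K, hK, δ₁, hδ₁, hupper⟩ := exists_upper_face_of_close hP.isCompact p u (half_pos hρ) hux
  refine ⟨min δ₁ (min (ε / 2) (min (η / (2 * (K + ‖u‖ + ‖p‖ + 1))) (ε / (2 * (K + 1))))),
    by positivity, fun δ hδ Q hQ hPQ hQP => ?_⟩
  simp only [le_min_iff] at hδ
  obtain ⟨hd1, hd2, hd3, hd4⟩ := hδ
  rw [le_div_iff₀ (by positivity)] at hd3 hd4
  have hδ0 : 0 ≤ δ := by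
    obtain ⟨q, hq⟩ := hQ.nonempty
    obtain ⟨f, -, hf⟩ := hQP q hq
    exact dist_nonneg.trans hf
  have hKδ := mul_nonneg hK hδ0
  have huδ := mul_nonneg (norm_nonneg u) hδ0
  have hpδ := mul_nonneg (norm_nonneg p) hδ0
  -- A point `w` off the projections of all faces of dimension below `dim F` forces the upper face
  -- over `w` to have at least that dimension.
  let S : Set (Set (vectorSpan ℝ F)) := (fun H => p '' H) ''
    {H | IsPolytopeFace Q H ∧
      Module.finrank ℝ (vectorSpan ℝ H) < Module.finrank ℝ (vectorSpan ℝ F)}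
  have hS : S.Finite := (hQ.finite_faces.subset fun H hH => hH.1).image _
  obtain ⟨w, hw, hwS⟩ := exists_mem_ball_notMem_of_finrank_vectorSpan_lt hS (by
    rintro _ ⟨H, hH, rfl⟩
    rw [ContinuousLinearMap.vectorSpan_image]
    exact (Submodule.finrank_map_le _ _).trans_lt hH.2) (p x)
    (lt_min (half_pos hρ) (half_pos hη))
  rw [Metric.mem_ball, lt_min_iff] at hw
  obtain ⟨y, H, hyw, hH, hyH, hdim, hlow⟩ := hupper δ hd1 w Q hQ (fun z hz => by
    have hz' : w + z ∈ Metric.closedBall (p x) ρ := by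
      rw [Metric.mem_closedBall, dist_eq_norm]
      rw [mem_closedBall_zero_iff] at hz
      rw [dist_eq_norm] at hw
      calc ‖w + z - p x‖ = ‖(w - p x) + z‖ := by congr 1; abel
        _ ≤ ‖w - p x‖ + ‖z‖ := norm_add_le _ _
        _ ≤ ρ := by linarith [hw.1]
    obtain ⟨f, hf, hfz⟩ := hball hz'
    exact ⟨f, hF.subset hf, hfz, huF f hf⟩) hPQ hQP
  refine ⟨H, hH, ⟨y, hyH⟩, hdim.antisymm ?_, ⟨y, hyH, ?_⟩, fun h hh => ?_⟩
  · by_contra! hlt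
    exact hwS _ ⟨H, ⟨hH, hlt⟩, rfl⟩ ⟨y, hyH, hyw⟩
  · obtain ⟨f, hf, hyf⟩ := hQP y (hH.subset hyH)
    have h1 : u (y - f) ≤ ‖u‖ * δ := (le_abs_self _).trans ((u.le_opNorm _).trans
      (mul_le_mul_of_nonneg_left (by rwa [← dist_eq_norm]) (norm_nonneg _)))
    have h2 : dist (p f) (p y) ≤ ‖p‖ * δ := by
      rw [dist_comm, dist_eq_norm, ← map_sub]
      exact (p.le_opNorm _).trans
        (mul_le_mul_of_nonneg_left (by rwa [← dist_eq_norm]) (norm_nonneg _))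
    have h3 := hη' f hf (by
      have := hlow y hyH
      rw [map_sub] at h1
      nlinarith) (by
      have := dist_triangle (p f) (p y) (p x)
      rw [hyw] at this h2
      nlinarith [hw.2])
    linarith [dist_triangle y f x]
  · have := hlow h hh
    nlinarith

end

/-! ### Lower semicontinuity of face numbers -/

theorem polyDim_eq_finrank {E : Type*} [AddCommGroup E] [Module ℝ E] {F : Set E}
    (h : F.Nonempty) : polyDim F = Module.finrank ℝ (vectorSpan ℝ F) := by
  rw [polyDim, if_pos h]

theorem polyDim_empty {E : Type*} [AddCommGroup E] [Module ℝ E] :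
    polyDim (∅ : Set E) = -1 := by
  rw [polyDim, if_neg Set.not_nonempty_empty]

/-- Lower semicontinuity of the face numbers of polytopes with respect to the Hausdorff
distance. -/
theorem IsConvexPolytope.exists_forall_faceNumber_le {E : Type*} [NormedAddCommGroup E]
    [InnerProductSpace ℝ E] [FiniteDimensional ℝ E] {P : Set E} (hP : IsConvexPolytope P) :
    ∃ δ > 0, ∀ Q, IsConvexPolytope Q →
      (∀ f ∈ P, ∃ q ∈ Q, dist f q ≤ δ) → (∀ q ∈ Q, ∃ f ∈ P, dist q f ≤ δ) →
      ∀ k, faceNumber P k ≤ faceNumber Q k := by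
  classical
  have hfin : {F | IsPolytopeFace P F ∧ F.Nonempty}.Finite :=
    hP.finite_faces.subset fun F hF => hF.1
  have := hfin.to_subtype
  choose x hxF u hFu hsub hclose using
    fun F : {F | IsPolytopeFace P F ∧ F.Nonempty} =>
      IsPolytopeFace.exists_close hP F.2.1 F.2.2
  have hsep : ∀ F G : {F | IsPolytopeFace P F ∧ F.Nonempty}, ∃ ε > 0, x F ∉ (G : Set E) → ∀ y, dist y (x F) < ε →
      u G y ≤ u G (x G) - ε := by
    intro F G
    by_cases h : x F ∈ (G : Set E)
    · exact ⟨1, one_pos, fun h' => absurd h h'⟩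
    have hxG : x G ∈ (u G).toExposed P := hFu G ▸ hxF G
    have hlt : u G (x F) < u G (x G) := by
      by_contra! hc
      refine h (hFu G ▸ ⟨F.2.1.subset (hxF F), fun y hy => (hxG.2 y hy).trans hc⟩)
    have hev : ∀ᶠ y in nhds (x F), u G y < (u G (x F) + u G (x G)) / 2 :=
      (u G).continuous.continuousAt.eventually_lt_const (by linarith)
    obtain ⟨r, hr, hball⟩ := Metric.eventually_nhds_iff.1 hev
    refine ⟨min r ((u G (x G) - u G (x F)) / 2), lt_min hr (by linarith), fun _ y hy => ?_⟩
    have h1 := hball (lt_min_iff.1 hy).1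
    have h2 := min_le_right r ((u G (x G) - u G (x F)) / 2)
    linarith
  choose ε hε hεsep using hsep
  have hmin : ∃ e > 0, ∀ F G, e ≤ ε F G := by
    have h : ∀ᶠ e in nhdsWithin (0 : ℝ) (Set.Ioi 0), ∀ F G, e ≤ ε F G := by
      simp only [Filter.eventually_all]
      exact fun F G => Filter.mem_of_superset (Ioo_mem_nhdsGT (hε F G)) fun e he => he.2.le
    exact (h.and self_mem_nhdsWithin).exists.imp fun e he => ⟨he.2, he.1⟩
  obtain ⟨e, he, hemin⟩ := hmin
  have hδ : ∃ δ > 0, ∀ F, δ ≤ (hclose F e he).choose := by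
    have h : ∀ᶠ δ in nhdsWithin (0 : ℝ) (Set.Ioi 0), ∀ F, δ ≤ (hclose F e he).choose := by
      simp only [Filter.eventually_all]
      exact fun F => Filter.mem_of_superset (Ioo_mem_nhdsGT (hclose F e he).choose_spec.1)
        fun e he => he.2.le
    exact (h.and self_mem_nhdsWithin).exists.imp fun e he => ⟨he.2, he.1⟩
  obtain ⟨δ, hδ0, hδ⟩ := hδ
  refine ⟨δ, hδ0, fun Q hQ hPQ hQP k => ?_⟩
  choose H hH hHne hHdim hHx hHu using
    fun F => (hclose F e he).choose_spec.2 δ (hδ F) Q hQ hPQ hQP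
  -- The common face has a point near `x F`, where `u G` is almost maximal. By the choice of `ε`
  -- this puts `x F` in `G`, and a face containing the relative interior point `x F` contains `F`.
  have hle : ∀ F G, H F = H G → (F : Set E) ⊆ G := by
    intro F G hFG
    refine hsub F G G.2.1 ?_
    by_contra hc
    obtain ⟨y, hy, hyx⟩ := hHx F
    have h1 := hεsep F G hc y (hyx.trans_le (hemin F G))
    have h2 := hHu G y (hFG ▸ hy)
    linarith [hemin F G]
  -- The value `∅` at the empty face covers `k = -1`.
  refine Set.ncard_le_ncard_of_injOn
    (fun F => if h : IsPolytopeFace P F ∧ F.Nonempty then H ⟨F, h⟩ else ∅) ?_ ?_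
    (hQ.finite_faces.subset fun F hF => hF.1)
  · rintro F ⟨hF, hk⟩
    rcases F.eq_empty_or_nonempty with rfl | hne
    · simp only [Set.not_nonempty_empty, and_false, dite_false]
      exact ⟨isExposed_empty, hk⟩
    · have h : IsPolytopeFace P F ∧ F.Nonempty := ⟨hF, hne⟩
      simp only [dif_pos h]
      refine ⟨hH _, ?_⟩
      rw [polyDim_eq_finrank (hHne _), hHdim, ← polyDim_eq_finrank hne, hk]
  · rintro F ⟨hF, -⟩ G ⟨hG, -⟩ hFG
    rcases F.eq_empty_or_nonempty with rfl | hne <;> rcases G.eq_empty_or_nonempty with rfl | hne'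
    · rfl
    · simp only [Set.not_nonempty_empty, and_false, dite_false, hG, hne', and_self, dite_true]
        at hFG
      exact absurd (hFG ▸ hHne _) Set.not_nonempty_empty
    · simp only [Set.not_nonempty_empty, and_false, dite_false, hF, hne, and_self, dite_true]
        at hFG
      exact absurd (hFG ▸ hHne _) Set.not_nonempty_empty
    · simp only [hF, hne, hG, hne', and_self, dite_true] at hFG
      exact (hle ⟨F, hF, hne⟩ ⟨G, hG, hne'⟩ hFG).antisymm (hle ⟨G, hG, hne'⟩ ⟨F, hF, hne⟩ hFG.symm)

/-! ### Generic linear maps -/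

/-- A line through a linearly independent family meets the linearly dependent families in a
finite set. -/
theorem LinearIndependent.finite_setOf_not_add_smul {ι E : Type*} [Finite ι] [AddCommGroup E]
    [Module ℝ E] {v : ι → E} (hv : LinearIndependent ℝ v) (w : ι → E) :
    {s : ℝ | ¬ LinearIndependent ℝ (w + s • v)}.Finite := by
  classical
  have := Fintype.ofFinite ι
  obtain ⟨g, hg⟩ := LinearMap.exists_leftInverse_of_injective
    (Finsupp.linearCombination ℝ v) (LinearMap.ker_eq_bot.2 hv)
  -- In the coordinates given by `g`, the family `w + s • v` has matrix `s + A`, whose determinant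
  -- is the characteristic polynomial of `-A` at `s`.
  let A : Matrix ι ι ℝ := Matrix.of fun i j => g (w i) j
  refine ((-A).charpoly.roots.toFinset.finite_toSet).subset fun s hs => ?_
  rw [Finset.mem_coe, Multiset.mem_toFinset,
    Polynomial.mem_roots (Matrix.charpoly_monic _).ne_zero, Polynomial.IsRoot,
    Matrix.eval_charpoly]
  by_contra hdet
  refine hs ?_
  have hrow : LinearIndependent ℝ (Matrix.scalar ι s - -A).row :=
    Matrix.linearIndependent_rows_of_det_ne_zero hdet
  refine LinearIndependent.of_comp
    ((Finsupp.linearEquivFunOnFinite ℝ ℝ ι).toLinearMap ∘ₗ g) ?_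
  convert hrow using 1
  ext i j
  have hgv : g (v i) = Finsupp.single i 1 := by
    have := LinearMap.congr_fun hg (Finsupp.single i 1)
    simpa using this
  simp [A, hgv, Matrix.row, Matrix.diagonal_apply, Finsupp.single_apply, add_comm]

/-- Openness allows finitely many dense conditions to be imposed together. -/
theorem isOpen_setOf_linearIndependent_apply {E : Type*} [NormedAddCommGroup E] [NormedSpace ℝ E]
    {ι κ : Type*} [Finite ι] [Finite κ] (a : κ → ι)
    (b : κ → E) : IsOpen {T : ι → E →L[ℝ] E | LinearIndependent ℝ fun j => T (a j) (b j)} :=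
  (isOpen_setOfPred_linearIndependent (𝕜 := ℝ) (E := E) (ι := κ)).preimage
    (f := fun T : ι → E →L[ℝ] E => fun j => T (a j) (b j)) (by fun_prop)

section

variable {E : Type*} [NormedAddCommGroup E] [NormedSpace ℝ E] [FiniteDimensional ℝ E]

/-- For bases `b i` of subspaces `L i`, and generic linear maps `T i`, the vectors `T i (b i j)`,
`(i, j) ∈ S`, are linearly independent, provided that there are at most `dim E` of them. -/
theorem dense_setOf_linearIndependent_apply {ι κ : Type*} [Finite ι] [Finite κ] (a : κ → ι)
    (b : κ → E) (hκ : Nat.card κ ≤ Module.finrank ℝ E)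
    (hb : ∀ i, LinearIndependent ℝ fun j : {j // a j = i} => b j) :
    Dense {T : ι → E →L[ℝ] E | LinearIndependent ℝ fun j => T (a j) (b j)} := by
  have := Fintype.ofFinite κ
  have := Fintype.ofFinite ι
  obtain ⟨e⟩ : Nonempty (κ ↪ Fin (Module.finrank ℝ E)) :=
    Function.Embedding.nonempty_of_card_le (by simpa using hκ)
  let β := Module.finBasis ℝ E
  -- One good tuple suffices: `B` sends the `b j` to distinct basis vectors of `E`, and on the line
  -- `T + s • B` only finitely many `s` are bad.
  have hB : ∀ i, ∃ B : E →ₗ[ℝ] E, ∀ j : {j // a j = i}, B (b j) = β (e j) := by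
    intro i
    let γ := Module.Basis.span (hb i)
    obtain ⟨B, hB⟩ := LinearMap.exists_extend (γ.constr ℝ fun j => β (e j))
    refine ⟨B, fun j => ?_⟩
    have h1 := LinearMap.congr_fun hB (γ j)
    rw [Module.Basis.constr_basis] at h1
    rw [← h1, LinearMap.comp_apply, Submodule.subtype_apply, Module.Basis.span_apply]
  choose B hB using hB
  have hv : LinearIndependent ℝ fun j => B (a j) (b j) := by
    have : (fun j => B (a j) (b j)) = fun j => β (e j) := funext fun j => hB (a j) ⟨j, rfl⟩
    rw [this]
    exact β.linearIndependent.comp e e.injective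
  intro T
  have hfin := hv.finite_setOf_not_add_smul fun j => T (a j) (b j)
  have hcont : Continuous fun s : ℝ => fun i => T i + s • LinearMap.toContinuousLinearMap (B i) := by
    fun_prop
  have h0 : (0 : ℝ) ∈ closure {s : ℝ | ¬ LinearIndependent ℝ
      ((fun j => T (a j) (b j)) + s • fun j => B (a j) (b j))}ᶜ :=
    (hfin.countable.dense_compl ℝ) 0
  have := map_mem_closure hcont h0 (t := {T : ι → E →L[ℝ] E |
    LinearIndependent ℝ fun j => T (a j) (b j)}) fun s hs => by
      simpa [Pi.add_def, Pi.smul_def] using not_not.1 hs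
  simpa using this

/-- Generic linear images of subspaces are in general position. -/
theorem exists_isOpen_dense_le_finrank_iSup_map {ι : Type*} [Fintype ι] (L : ι → Submodule ℝ E) :
    ∃ U : Set (ι → E →L[ℝ] E), IsOpen U ∧ Dense U ∧ ∀ T ∈ U,
      min (Module.finrank ℝ E) (∑ i, Module.finrank ℝ (L i)) ≤
        Module.finrank ℝ (⨆ i, (L i).map (T i : E →ₗ[ℝ] E) : Submodule ℝ E) := by
  classical
  let κ := Σ i, Fin (Module.finrank ℝ (L i))
  have hcard : Fintype.card κ = ∑ i, Module.finrank ℝ (L i) := by simp [κ]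
  -- Only as many basis vectors are kept as can be independent in `E`.
  obtain ⟨S, -, hS⟩ := Finset.exists_subset_card_eq (s := (Finset.univ : Finset κ))
    (n := min (Module.finrank ℝ E) (∑ i, Module.finrank ℝ (L i)))
    (by rw [Finset.card_univ, hcard]; exact min_le_right _ _)
  let b : S → E := fun j => Module.finBasis ℝ (L j.1.1) j.1.2
  refine ⟨{T | LinearIndependent ℝ fun j : S => T j.1.1 (b j)},
    isOpen_setOf_linearIndependent_apply (fun j : S => j.1.1) b,
    dense_setOf_linearIndependent_apply (fun j : S => j.1.1) b (by simp [hS]) fun i => ?_,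
    fun T hT => ?_⟩
  · have h1 : LinearIndependent ℝ fun j => (Module.finBasis ℝ (L i) j : E) :=
      (Module.finBasis ℝ (L i)).linearIndependent.map' (L i).subtype (Submodule.ker_subtype _)
    have key : ∀ j : {j : S // j.1.1 = i}, b j.1 =
        (Module.finBasis ℝ (L i) (j.2 ▸ j.1.1.2) : E) := by
      rintro ⟨⟨⟨i', j⟩, hj⟩, rfl⟩
      rfl
    have h2 := h1.comp (fun j : {j : S // j.1.1 = i} =>
      (j.2 ▸ j.1.1.2 : Fin (Module.finrank ℝ (L i)))) (by
        rintro ⟨⟨⟨i', j⟩, hj⟩, rfl⟩ ⟨⟨⟨i'', j'⟩, hj'⟩, h⟩ heq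
        dsimp only at h
        subst h
        obtain rfl : j = j' := heq
        rfl)
    convert h2 using 1
    exact funext key
  · have hle : Submodule.span ℝ (Set.range fun j : S => T j.1.1 (b j)) ≤
        ⨆ i, (L i).map (T i : E →ₗ[ℝ] E) := by
      rw [Submodule.span_le]
      rintro _ ⟨j, rfl⟩
      exact Submodule.mem_iSup_of_mem j.1.1 ⟨b j, (Module.finBasis ℝ (L j.1.1) j.1.2).2, rfl⟩
    have h := finrank_span_eq_card hT
    rw [Fintype.card_coe, hS] at h
    rw [← h]
    exact Submodule.finrank_mono hle

/-- Linear maps that are generic with respect to finitely many families of subspaces are dense. -/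
theorem dense_setOf_forall_le_finrank_iSup_map {ι : Type*} [Fintype ι]
    {S : Set (ι → Submodule ℝ E)} (hS : S.Finite) :
    Dense {T : ι → E →L[ℝ] E | ∀ L ∈ S,
      min (Module.finrank ℝ E) (∑ i, Module.finrank ℝ (L i)) ≤
        Module.finrank ℝ (⨆ i, (L i).map (T i : E →ₗ[ℝ] E) : Submodule ℝ E)} := by
  have := hS.to_subtype
  choose U hUo hUd hU using fun L : S => exists_isOpen_dense_le_finrank_iSup_map (L : ι → Submodule ℝ E)
  refine (dense_iInter_of_isOpen hUo hUd).mono fun T hT L hL => ?_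
  exact hU ⟨L, hL⟩ T (Set.mem_iInter.1 hT _)

end

/-! ### Minkowski sums, linear images and their faces -/

theorem mem_minkowskiSum {ι E : Type*} [Fintype ι] [AddCommMonoid E] {P : ι → Set E} {x : E} :
    x ∈ ∑ i, P i ↔ ∃ g : ι → E, (∀ i, g i ∈ P i) ∧ ∑ i, g i = x := by
  rw [Set.mem_fintype_sum]
  simp only [exists_prop]

section

variable {E : Type*} [AddCommGroup E] [Module ℝ E]

theorem IsConvexPolytope.sum {ι : Type*} (s : Finset ι) {P : ι → Set E}
    (hP : ∀ i ∈ s, IsConvexPolytope (P i)) : IsConvexPolytope (∑ i ∈ s, P i) := by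
  classical
  refine Finset.sum_induction P IsConvexPolytope ?_ ?_ hP
  · rintro _ _ ⟨s, hs, rfl⟩ ⟨t, ht, rfl⟩
    exact ⟨s + t, hs.add ht, by rw [Finset.coe_add, convexHull_add]⟩
  · exact ⟨{0}, Finset.singleton_nonempty 0, by simp [Set.singleton_zero]⟩

theorem IsConvexPolytope.image {W : Type*} [AddCommGroup W] [Module ℝ W] {P : Set E}
    (hP : IsConvexPolytope P) (f : E →ₗ[ℝ] W) : IsConvexPolytope (f '' P) := by
  classical
  obtain ⟨s, hs, rfl⟩ := hP
  exact ⟨s.image f, hs.image f, by rw [Finset.coe_image, f.image_convexHull]⟩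

/-- The direction of a Minkowski sum is the sum of the directions. -/
theorem vectorSpan_sum {ι : Type*} [Fintype ι] {G : ι → Set E} (hG : ∀ i, (G i).Nonempty) :
    vectorSpan ℝ (∑ i, G i) = ⨆ i, vectorSpan ℝ (G i) := by
  classical
  refine le_antisymm ?_ (iSup_le fun i => ?_)
  · rw [vectorSpan_def, Submodule.span_le]
    rintro _ ⟨x, hx, y, hy, rfl⟩
    obtain ⟨g, hg, rfl⟩ := mem_minkowskiSum.1 hx
    obtain ⟨h, hh, rfl⟩ := mem_minkowskiSum.1 hy
    dsimp only
    rw [vsub_eq_sub, ← Finset.sum_sub_distrib]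
    exact sum_mem fun i _ => Submodule.mem_iSup_of_mem i (vsub_mem_vectorSpan ℝ (hg i) (hh i))
  · rw [vectorSpan_def, Submodule.span_le]
    rintro _ ⟨x, hx, y, hy, rfl⟩
    choose g hg using hG
    have hmem : ∀ z ∈ G i, ∑ j, Function.update g i z j ∈ ∑ i, G i := fun z hz => by
      refine mem_minkowskiSum.2 ⟨_, fun j => ?_, rfl⟩
      by_cases hj : j = i
      · subst hj; simpa
      · simpa [hj] using hg j
    have := vsub_mem_vectorSpan ℝ (hmem x hx) (hmem y hy)
    simpa [Finset.sum_update_of_mem] using this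

end

section

variable {E W : Type*} [AddCommGroup E] [Module ℝ E] [TopologicalSpace E]
  [AddCommGroup W] [Module ℝ W] [TopologicalSpace W]

/-- The maximizers of a functional over a Minkowski sum. -/
theorem toExposed_sum {ι : Type*} [Fintype ι] (l : StrongDual ℝ E) (P : ι → Set E) :
    l.toExposed (∑ i, P i) = ∑ i, l.toExposed (P i) := by
  classical
  ext x
  rw [mem_minkowskiSum]
  constructor
  · rintro ⟨hx, hmax⟩
    obtain ⟨g, hg, rfl⟩ := mem_minkowskiSum.1 hx
    refine ⟨g, fun i => ⟨hg i, fun y hy => ?_⟩, rfl⟩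
    have h := hmax (∑ j, Function.update g i y j) (mem_minkowskiSum.2 ⟨_, fun j => by
      by_cases hj : j = i
      · subst hj; simpa
      · simpa [hj] using hg j, rfl⟩)
    rw [Finset.sum_update_of_mem (Finset.mem_univ i), ← Finset.erase_eq,
      ← Finset.add_sum_erase _ g (Finset.mem_univ i), map_add, map_add] at h
    linarith
  · rintro ⟨g, hg, rfl⟩
    refine ⟨mem_minkowskiSum.2 ⟨g, fun i => (hg i).1, rfl⟩, fun y hy => ?_⟩
    obtain ⟨h, hh, rfl⟩ := mem_minkowskiSum.1 hy
    rw [map_sum, map_sum]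
    exact Finset.sum_le_sum fun i _ => (hg i).2 _ (hh i)

theorem toExposed_image (l : StrongDual ℝ W) (f : E →L[ℝ] W) (P : Set E) :
    l.toExposed (f '' P) = f '' (l.comp f).toExposed P := by
  ext x
  constructor
  · rintro ⟨⟨x, hx, rfl⟩, h⟩
    exact ⟨x, ⟨hx, fun y hy => h _ ⟨y, hy, rfl⟩⟩, rfl⟩
  · rintro ⟨x, ⟨hx, h⟩, rfl⟩
    refine ⟨⟨x, hx, rfl⟩, ?_⟩
    rintro _ ⟨y, hy, rfl⟩
    exact h y hy

theorem IsPolytopeFace.image_equiv {P F : Set E} (hF : IsPolytopeFace P F) (e : E ≃L[ℝ] W) :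
    IsPolytopeFace (e '' P) (e '' F) := by
  rintro ⟨_, x, hx, rfl⟩
  obtain ⟨l, hl⟩ := hF ⟨x, hx⟩
  refine ⟨l.comp (e.symm : W →L[ℝ] E), ?_⟩
  change _ = ContinuousLinearMap.toExposed _ (e '' P)
  rw [show (e '' P) = (e : E →L[ℝ] W) '' P from rfl, toExposed_image]
  have : (l.comp (e.symm : W →L[ℝ] E)).comp (e : E →L[ℝ] W) = l := by
    ext y; simp
  rw [this, hl]
  rfl

theorem polyDim_image_equiv (e : E ≃L[ℝ] W) (F : Set E) : polyDim (e '' F) = polyDim F := by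
  rcases F.eq_empty_or_nonempty with rfl | h
  · rw [Set.image_empty, polyDim_empty, polyDim_empty]
  · rw [polyDim_eq_finrank h, polyDim_eq_finrank (h.image _)]
    have := (e.toLinearEquiv.toLinearMap.toAffineMap.map_vectorSpan (s := F))
    have h2 := LinearEquiv.finrank_map_eq e.toLinearEquiv (vectorSpan ℝ F)
    rw [← h2]
    exact congrArg (fun S : Submodule ℝ W => (Module.finrank ℝ S : ℤ)) this.symm

theorem faceNumber_image_equiv (e : E ≃L[ℝ] W) (P : Set E) (k : ℤ) :
    faceNumber (e '' P) k = faceNumber P k := by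
  have : {F : Set W | IsPolytopeFace (e '' P) F ∧ polyDim F = k} =
      (fun F => e '' F) '' {F : Set E | IsPolytopeFace P F ∧ polyDim F = k} := by
    ext F
    constructor
    · rintro ⟨hF, hk⟩
      refine ⟨e.symm '' F, ⟨?_, by rw [polyDim_image_equiv, hk]⟩, ?_⟩
      · simpa [Set.image_image] using hF.image_equiv e.symm
      · simp [Set.image_image]
    · rintro ⟨F, ⟨hF, hk⟩, rfl⟩
      exact ⟨hF.image_equiv e, by rw [polyDim_image_equiv, hk]⟩
  rw [faceNumber, this, Set.ncard_image_of_injective _ e.injective.image_injective, faceNumber]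

end

/-! ### General position and bounds for the sum -/

section

variable {E : Type*} [NormedAddCommGroup E] [NormedSpace ℝ E]

theorem finrank_iSup_le_sum [FiniteDimensional ℝ E] {ι : Type*} [Fintype ι]
    (L : ι → Submodule ℝ E) :
    Module.finrank ℝ (⨆ i, L i : Submodule ℝ E) ≤ ∑ i, Module.finrank ℝ (L i) := by
  classical
  rw [← Finset.sup_univ_eq_iSup]
  induction (Finset.univ : Finset ι) using Finset.induction_on with
  | empty => simp
  | insert a s ha ih =>
    rw [Finset.sup_insert, Finset.sum_insert ha]
    exact (Submodule.finrank_add_le_finrank_add_finrank _ _).trans (by gcongr)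

/-- Linear images of polytopes are relatively in general position, if the images of the directions
of their faces are in general position as subspaces. -/
theorem relativelyInGeneralPosition_image [FiniteDimensional ℝ E] {r : ℕ} {P : Fin r → Set E}
    {T : Fin r → E →L[ℝ] E}
    (hT : ∀ G : Fin r → Set E, (∀ i, IsPolytopeFace (P i) (G i)) →
      min (Module.finrank ℝ E) (∑ i, Module.finrank ℝ (vectorSpan ℝ (G i))) ≤
        Module.finrank ℝ (⨆ i, (vectorSpan ℝ (G i)).map (T i : E →ₗ[ℝ] E) : Submodule ℝ E)) :
    RelativelyInGeneralPosition fun i => T i '' P i := by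
  intro F hF hne hdim
  obtain ⟨l, hl⟩ := hF hne
  have hl' : F = ∑ i, T i '' (l.comp (T i)).toExposed (P i) := by
    rw [hl]
    change l.toExposed (∑ i, T i '' P i) = _
    rw [toExposed_sum]
    simp only [toExposed_image]
  set G : Fin r → Set E := fun i => (l.comp (T i)).toExposed (P i)
  have hGne : ∀ i, (G i).Nonempty := by
    rw [hl'] at hne
    obtain ⟨x, hx⟩ := hne
    obtain ⟨g, hg, -⟩ := mem_minkowskiSum.1 hx
    exact fun i => Set.image_nonempty.1 ⟨g i, hg i⟩
  refine ⟨fun i => T i '' G i, ⟨fun i => ?_, hl'⟩, ?_⟩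
  · change IsPolytopeFace _ (T i '' (l.comp (T i)).toExposed (P i))
    rw [← toExposed_image]
    exact ContinuousLinearMap.toExposed.isExposed
  have hFdim : polyDim F =
      Module.finrank ℝ (⨆ i, (vectorSpan ℝ (G i)).map (T i : E →ₗ[ℝ] E) : Submodule ℝ E) := by
    rw [polyDim_eq_finrank hne, hl', vectorSpan_sum fun i => (hGne i).image _]
    rw [iSup_congr fun i => ContinuousLinearMap.vectorSpan_image (T i) (G i)]
  -- A facet has dimension below `dim E`, so the minimum in `hT` is the sum of the dimensions;
  -- subadditivity gives the reverse inequality.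
  have hlt : polyDim F < Module.finrank ℝ E := by
    rw [hdim, polyDim_eq_finrank (hne.mono hF.subset)]
    exact (sub_one_lt _).trans_le (Nat.cast_le.2 (Submodule.finrank_le _))
  have hle := hT G fun i => ContinuousLinearMap.toExposed.isExposed
  have h1 := finrank_iSup_le_sum fun i => (vectorSpan ℝ (G i)).map (T i : E →ₗ[ℝ] E)
  have h2 : ∑ i, Module.finrank ℝ ((vectorSpan ℝ (G i)).map (T i : E →ₗ[ℝ] E)) ≤
      ∑ i, Module.finrank ℝ (vectorSpan ℝ (G i)) :=
    Finset.sum_le_sum fun i _ => Submodule.finrank_map_le _ _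
  have h3 : ∀ i, polyDim (T i '' G i) =
      Module.finrank ℝ ((vectorSpan ℝ (G i)).map (T i : E →ₗ[ℝ] E)) := fun i => by
    rw [polyDim_eq_finrank ((hGne i).image _), ContinuousLinearMap.vectorSpan_image]
  rw [hFdim] at hlt ⊢
  rw [Finset.sum_congr rfl fun i _ => h3 i, ← Nat.cast_sum]
  omega

/-- Minkowski sums depend continuously on linear images of the bounded summands. -/
theorem eventually_dist_sum_le {ι : Type*} [Fintype ι] {P : ι → Set E}
    (hP : ∀ i, Bornology.IsBounded (P i)) {δ : ℝ} (hδ : 0 < δ) :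
    ∀ᶠ T in nhds (1 : ι → E →L[ℝ] E), ∀ g : ι → E, (∀ i, g i ∈ P i) →
      dist (∑ i, g i) (∑ i, T i (g i)) ≤ δ := by
  choose C hC using fun i => (hP i).exists_norm_le
  have hcont : Continuous fun T : ι → E →L[ℝ] E => ∑ i, ‖1 - T i‖ * C i := by fun_prop
  have h0 := hcont.continuousAt (x := 1) |>.eventually_lt_const (u := δ) (by simpa using hδ)
  filter_upwards [h0] with T hT g hg
  rw [dist_eq_norm, ← Finset.sum_sub_distrib]
  refine (norm_sum_le_of_le _ fun i _ => ?_).trans hT.le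
  exact ((1 - T i).le_opNorm (g i)).trans
    (mul_le_mul_of_nonneg_left (hC i _ (hg i)) (norm_nonneg _))

/-- The number of faces of a polytope is determined by its face numbers. -/
theorem IsConvexPolytope.ncard_faces_le [FiniteDimensional ℝ E] {P : Set E}
    (hP : IsConvexPolytope P) :
    {F | IsPolytopeFace P F}.ncard ≤
      ∑ k ∈ Finset.Icc (-1 : ℤ) (Module.finrank ℝ E), faceNumber P k := by
  classical
  have hcover : {F | IsPolytopeFace P F} ⊆ ⋃ k ∈ Finset.Icc (-1 : ℤ) (Module.finrank ℝ E),
      {F | IsPolytopeFace P F ∧ polyDim F = k} := by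
    intro F hF
    refine Set.mem_biUnion (x := polyDim F) ?_ ⟨hF, rfl⟩
    rw [Finset.mem_coe, Finset.mem_Icc]
    rcases F.eq_empty_or_nonempty with rfl | h
    · rw [polyDim_empty]
      omega
    · rw [polyDim_eq_finrank h]
      have := Submodule.finrank_le (vectorSpan ℝ F)
      omega
  exact (Set.ncard_le_ncard hcover (hP.finite_faces.subset fun F hF => by
    simp only [Set.mem_iUnion] at hF
    obtain ⟨k, -, hF⟩ := hF
    exact hF.1)).trans (Finset.set_ncard_biUnion_le _ _)

/-- The face numbers of a Minkowski sum are bounded by the product of the numbers of faces of the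
summands. -/
theorem faceNumber_sum_le [FiniteDimensional ℝ E] {ι : Type*} [Fintype ι] {P : ι → Set E}
    (hP : ∀ i, IsConvexPolytope (P i)) (k : ℤ) :
    faceNumber (∑ i, P i) k ≤
      ∏ i, (∑ j ∈ Finset.Icc (-1 : ℤ) (Module.finrank ℝ E), faceNumber (P i) j) + 1 := by
  classical
  let A : Finset (ι → Set E) := Fintype.piFinset fun i => (hP i).finite_faces.toFinset
  -- `∅` is inserted because for empty `ι` it is not a sum of faces: the only such sum is `{0}`.
  have hsub : {F | IsPolytopeFace (∑ i, P i) F ∧ polyDim F = k} ⊆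
      (insert ∅ (A.image fun G => ∑ i, G i) : Finset (Set E)) := by
    rintro F ⟨hF, -⟩
    rw [Finset.coe_insert, Finset.coe_image]
    rcases F.eq_empty_or_nonempty with rfl | hne
    · exact Set.mem_insert _ _
    obtain ⟨l, rfl⟩ := hF hne
    refine Set.mem_insert_of_mem _ ⟨fun i => l.toExposed (P i), ?_, (toExposed_sum l P).symm⟩
    rw [Finset.mem_coe, Fintype.mem_piFinset]
    exact fun i => (Set.Finite.mem_toFinset _).2 ContinuousLinearMap.toExposed.isExposed
  refine (Set.ncard_le_ncard hsub (Finset.finite_toSet _)).trans ?_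
  rw [Set.ncard_coe_finset]
  refine (Finset.card_insert_le _ _).trans (Nat.add_le_add_right (Finset.card_image_le.trans ?_) 1)
  rw [Fintype.card_piFinset]
  refine Finset.prod_le_prod' fun i _ => ?_
  rw [← Set.ncard_eq_toFinset_card _ (hP i).finite_faces]
  exact (hP i).ncard_faces_le

end

/-! ### Perturbation and the maximum -/

/-- Polytopes can be perturbed into relatively general position, without changing their face
numbers and without decreasing those of their Minkowski sum. -/
theorem exists_relativelyInGeneralPosition {E : Type*} [NormedAddCommGroup E]
    [InnerProductSpace ℝ E] [FiniteDimensional ℝ E] {r : ℕ} {P : Fin r → Set E}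
    (hP : ∀ i, IsConvexPolytope (P i)) :
    ∃ P' : Fin r → Set E, (∀ i, IsConvexPolytope (P' i)) ∧ RelativelyInGeneralPosition P' ∧
      (∀ (i : Fin r) (k : ℤ), faceNumber (P' i) k = faceNumber (P i) k) ∧
      ∀ k : ℤ, faceNumber (∑ i, P i) k ≤ faceNumber (∑ i, P' i) k := by
  obtain ⟨δ, hδ, hclose⟩ :=
    (IsConvexPolytope.sum Finset.univ fun i _ => hP i).exists_forall_faceNumber_le
  -- These directions belong to the original `P i`, so the genericity condition is fixed before `T`
  -- is chosen.
  have hS : (Set.univ.pi fun i => vectorSpan ℝ '' {G | IsPolytopeFace (P i) G}).Finite :=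
    Set.Finite.pi fun i => (hP i).finite_faces.image _
  have hunit : ∀ᶠ T in nhds (1 : Fin r → E →L[ℝ] E), ∀ i, IsUnit (T i) :=
    Filter.eventually_all.2 fun i => (continuous_apply i).continuousAt.eventually
      (Units.isOpen.mem_nhds isUnit_one)
  obtain ⟨T, hTgen, hTdist, hTunit⟩ := ((dense_setOf_forall_le_finrank_iSup_map hS).inter_nhds_nonempty
    ((eventually_dist_sum_le (fun i => (hP i).isCompact.isBounded) hδ).and hunit))
  have hpoly : ∀ i, IsConvexPolytope (T i '' P i) := fun i => (hP i).image (T i : E →ₗ[ℝ] E)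
  refine ⟨fun i => T i '' P i, hpoly, relativelyInGeneralPosition_image fun G hG => ?_, ?_, ?_⟩
  · exact hTgen (fun i => vectorSpan ℝ (G i)) fun i _ => ⟨G i, hG i, rfl⟩
  · intro i k
    obtain ⟨e, he⟩ := hTunit i
    have : ⇑(T i) = ContinuousLinearEquiv.unitsEquiv ℝ E e := by
      rw [← he]; rfl
    change faceNumber (T i '' P i) k = _
    rw [this]
    exact faceNumber_image_equiv _ _ k
  · refine hclose _ (IsConvexPolytope.sum Finset.univ fun i _ => hpoly i) ?_ ?_
    · intro f hf
      obtain ⟨g, hg, rfl⟩ := mem_minkowskiSum.1 hf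
      exact ⟨∑ i, T i (g i), mem_minkowskiSum.2 ⟨_, fun i => ⟨g i, hg i, rfl⟩, rfl⟩,
        hTdist g hg⟩
    · intro q hq
      obtain ⟨h, hh, rfl⟩ := mem_minkowskiSum.1 hq
      choose g hg hgh using hh
      refine ⟨∑ i, g i, mem_minkowskiSum.2 ⟨g, hg, rfl⟩, ?_⟩
      rw [dist_comm]
      simpa only [hgh] using hTdist g hg

theorem theorem1 (d r : ℕ) (P : Fin r → Set (EuclideanSpace ℝ (Fin d)))
    (hP : ∀ i, IsConvexPolytope (P i)) :
    (∃ P' : Fin r → Set (EuclideanSpace ℝ (Fin d)),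
      (∀ i, IsConvexPolytope (P' i)) ∧
      RelativelyInGeneralPosition P' ∧
      (∀ (i : Fin r) (k : ℤ), faceNumber (P' i) k = faceNumber (P i) k) ∧
      (∀ k : ℤ, faceNumber (∑ i, P i) k ≤ faceNumber (∑ i, P' i) k)) ∧
    (∀ k : ℤ, ∃ P' : Fin r → Set (EuclideanSpace ℝ (Fin d)),
      (∀ i, IsConvexPolytope (P' i)) ∧
      RelativelyInGeneralPosition P' ∧
      (∀ (i : Fin r) (j : ℤ), faceNumber (P' i) j = faceNumber (P i) j) ∧
      (∀ Q : Fin r → Set (EuclideanSpace ℝ (Fin d)),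
        (∀ i, IsConvexPolytope (Q i)) →
        (∀ (i : Fin r) (j : ℤ), faceNumber (Q i) j = faceNumber (P i) j) →
        faceNumber (∑ i, Q i) k ≤ faceNumber (∑ i, P' i) k)) := by
  refine ⟨exists_relativelyInGeneralPosition hP, fun k => ?_⟩
  let N : Set ℕ := {n | ∃ Q : Fin r → Set (EuclideanSpace ℝ (Fin d)),
    (∀ i, IsConvexPolytope (Q i)) ∧
    (∀ (i : Fin r) (j : ℤ), faceNumber (Q i) j = faceNumber (P i) j) ∧
    faceNumber (∑ i, Q i) k = n}
  have hbdd : BddAbove N := by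
    refine ⟨∏ i, (∑ j ∈ Finset.Icc (-1 : ℤ) (Module.finrank ℝ (EuclideanSpace ℝ (Fin d))),
      faceNumber (P i) j) + 1, ?_⟩
    rintro _ ⟨Q, hQ, hQP, rfl⟩
    simpa only [hQP] using faceNumber_sum_le hQ k
  -- A nonempty bounded set of naturals contains its supremum, so some `Q` is optimal; perturbing
  -- `Q` rather than `P` preserves optimality.
  obtain ⟨Q, hQ, hQP, hQk⟩ := Nat.sSup_mem (s := N) ⟨_, P, hP, fun _ _ => rfl, rfl⟩ hbdd
  obtain ⟨P', hP', hgen, hface, hle⟩ := exists_relativelyInGeneralPosition hQ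
  refine ⟨P', hP', hgen, fun i j => (hface i j).trans (hQP i j), fun R hR hRP => ?_⟩
  refine le_trans ?_ (hle k)
  rw [hQk]
  exact le_csSup hbdd ⟨R, hR, hRP, rfl⟩
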